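/- Let $A$ and $B$ be complex unital Banach algebras, both nonzero, and let $A\overline{\otimes}B$ be a Banach algebra that is the completion of the algebraic tensor product $A\otimes B$ with respect to a uniform crossnorm. That is, the norm is a (submultiplicative) algebra norm $\alpha$ on $A\otimes B$ such that $\alpha(x\otimes y)=\|x\|\,\|y\|$ for all $x\in A$, $y\in B$, and $\alpha((S\otimes T)u)\le\|S\|\,\|T\|\,\alpha(u)$ for all bounded linear operators $S$ on $A$, $T$ on $B$ and all $u\in A\otimes B$. For $K\subseteq\mathbb C$ let $\operatorname{iso}K$ be the set of isolated points of $K$ and $\operatorname{acc}K=K\setminus\operatorname{iso}K$. For an element $c$ of a unital Banach algebra with spectrum $\sigma(c)$, let $\Pi(c)\subseteq\operatorname{iso}\sigma(c)$ be the set of those isolated points of $\sigma(c)$ that are poles (of some order $p\ge 1$) of the resolvent function $\lambda\mapsto(\lambda-c)^{-1}$, and let $I(c)=\operatorname{iso}\sigma(c)\setminus\Pi(c)$. **Theorem.** Let $a\in A$ and $b\in B$. Then the following statements hold. (i) $\sigma(a)=\Pi(a)=\{0\}$ or $\sigma(b)=\Pi(b)=\{0\}$ if and only if $\sigma(a\otimes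 b)=\Pi(a\otimes b)=\{0\}$. (ii) Suppose that neither $a$ nor $b$ is nilpotent. Then $\sigma(a)=I(a)=\{0\}$ or $\sigma(b)=I(b)=\{0\}$ if and only if $\sigma(a\otimes b)=I(a\otimes b)=\{0\}$. (iii) If $0\in\Pi(a)$ and $b$ is invertible, or if $0\in\Pi(b)$ and $a$ is invertible, or if $0\in\Pi(a)\cap\Pi(b)$, then $0\in\Pi(a\otimes b)$. (iv) If $a$ is not nilpotent, $0\in\Pi(a)$ and $0\in I(b)$, then $0\in I(a\otimes b)$. Likewise, if $b$ is not nilpotent, $0\in\Pi(b)$ and $0\in I(a)$, then $0\in I(a\otimes b)$. (v) If $b$ is invertible and $0\in I(a)$, or if $a$ is invertible and $0\in I(b)$, then $0\in I(a\otimes b)$. (vi) If $0\in I(a)\cap I(b)$, then $0\in I(a\otimes b)$. (vii) If $\sigma(b)\neq\{0\}$ and $0\in\operatorname{acc}\sigma(a)$, or if $\sigma(a)\neq\{0\}$ and $0\in\operatorname{acc}\sigma(b)$, then $0\in\operatorname{acc}\sigma(a\otimes b)$. -/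

import Mathlib

open scoped TensorProduct
open Filter Topology

namespace TensorSpectrum

/-! ### Completed tensor product of two unital Banach algebras -/

section CompletedTensorProduct

universe u v

variable {A : Type u} {B : Type v} [NormedRing A] [NormedAlgebra ℂ A]
  [NormedRing B] [NormedAlgebra ℂ B]

/-- An algebra norm `α` on the algebraic tensor product `A ⊗ B` is a uniform crossnorm if
`α (a ⊗ b) = ‖a‖ ‖b‖`, and if for all bounded linear maps `S` on `A` and `T` on `B` the map
`S ⊗ T` is `α`-bounded with norm at most `‖S‖ ‖T‖`. -/
structure IsUniformCrossnorm (α : AlgebraNorm ℂ (A ⊗[ℂ] B)) : Prop where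
  cross : ∀ (a : A) (b : B), α (a ⊗ₜ[ℂ] b) = ‖a‖ * ‖b‖
  uniform : ∀ (S : A →L[ℂ] A) (T : B →L[ℂ] B) (x : A ⊗[ℂ] B),
    α (TensorProduct.map (S : A →ₗ[ℂ] A) (T : B →ₗ[ℂ] B) x) ≤ ‖S‖ * ‖T‖ * α x

/-- The algebraic tensor product `A ⊗ B`, regarded as an algebra normed by `α`. -/
def NormedTensor (_α : AlgebraNorm ℂ (A ⊗[ℂ] B)) : Type (max u v) := A ⊗[ℂ] B

noncomputable instance (α : AlgebraNorm ℂ (A ⊗[ℂ] B)) : NormedRing (NormedTensor α) :=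
  RingNorm.toNormedRing (R := A ⊗[ℂ] B) α.toRingNorm

noncomputable instance (α : AlgebraNorm ℂ (A ⊗[ℂ] B)) : NormedAlgebra ℂ (NormedTensor α) where
  __ := (inferInstance : Algebra ℂ (A ⊗[ℂ] B))
  norm_smul_le := fun c x => le_of_eq (map_smul_eq_mul α c (x : A ⊗[ℂ] B))

/-- The identity map from `A ⊗ B` to the same algebra, normed by `α`. -/
noncomputable def NormedTensor.of (α : AlgebraNorm ℂ (A ⊗[ℂ] B)) :
    (A ⊗[ℂ] B) ≃ₐ[ℂ] NormedTensor α :=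
  AlgEquiv.refl (R := ℂ) (A₁ := A ⊗[ℂ] B)

theorem NormedTensor.norm_of (α : AlgebraNorm ℂ (A ⊗[ℂ] B)) (x : A ⊗[ℂ] B) :
    ‖NormedTensor.of α x‖ = α x := rfl

/-- The Banach algebra obtained by completing `A ⊗ B` with respect to `α`. -/
abbrev CompletedTensor (α : AlgebraNorm ℂ (A ⊗[ℂ] B)) : Type (max u v) :=
  UniformSpace.Completion (NormedTensor α)

noncomputable instance (α : AlgebraNorm ℂ (A ⊗[ℂ] B)) : NormedAlgebra ℂ (CompletedTensor α) where
  norm_smul_le := norm_smul_le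

/-- The elementary tensor `a ⊗ b` as an element of the completed tensor product. -/
noncomputable def tmul (α : AlgebraNorm ℂ (A ⊗[ℂ] B)) (a : A) (b : B) : CompletedTensor α :=
  (NormedTensor.of α (a ⊗ₜ[ℂ] b) : CompletedTensor α)

end CompletedTensorProduct

/-! ### Isolated points, accumulation points and poles of the spectrum -/

/-- The isolated points of a set `K` of complex numbers. -/
def iso (K : Set ℂ) : Set ℂ := {z ∈ K | ¬ AccPt z (𝓟 K)}

/-- `acc K = K \ iso K`. -/
def acc (K : Set ℂ) : Set ℂ := K \ iso K

section Banach

variable {A : Type*} [NormedRing A] [NormedAlgebra ℂ A]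

/-- The isolated point `z` of `σ(a)` is a pole of order `p` of the resolvent function
`w ↦ (w - a)⁻¹`: the Laurent expansion of the resolvent around `z` starts with a nonzero multiple
of `(w - z)⁻ᵖ`, where `p ≥ 1`. -/
def IsPoleOfOrder (a : A) (z : ℂ) (p : ℕ) : Prop :=
  z ∈ iso (spectrum ℂ a) ∧ 1 ≤ p ∧ meromorphicOrderAt (resolvent a) z = ((-(p : ℤ) : ℤ) : WithTop ℤ)

/-- `Π(a)`, the set of poles of `a`. -/
def poles (a : A) : Set ℂ := {z | ∃ p : ℕ, IsPoleOfOrder a z p}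

/-- `I(a)`, the set of isolated points of `σ(a)` that are not poles. -/
def nonpoles (a : A) : Set ℂ := iso (spectrum ℂ a) \ poles a

end Banach

end TensorSpectrum

namespace TensorSpectrum

/-! ### Strongly π-regular elements -/

/-! The point `0` belongs to `Π(a)` exactly when `a` is a non-unit with a Drazin inverse
(`zero_mem_poles_iff`). This turns the pole condition into algebra: `σ(a) = Π(a) = {0}` means that
`a` is nilpotent, and strong π-regularity of both factors passes to `a ⊗ b`. The crossnorm makes `a
^ n ⊗ b ^ n` vanish only if one factor does, which settles (i).

To descend from `a ⊗ b` to a factor, uniformity of the norm provides bounded slice maps that are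
bimodule maps over one factor. If `a` is not nilpotent, slicing with a functional equal to `1` at `a
^ n` carries a Drazin relation for `a ⊗ b` to one for `b` (`IsCrossPair.isStronglyPiRegular_right`).
So a non-pole of `b` cannot become a pole of `a ⊗ b`.

For the spectra, Gelfand theory gives `σ(a ⊗ b) ⊆ σ(a) σ(b)`. The full reverse inclusion is not
needed: it suffices that `l * m ∈ σ(a ⊗ b)` for `l ∈ σ(a)` and a nonzero `m ∈ σ(b)` of maximal
modulus (`IsCrossPair.mem_spectrum`). Such an `m` is an approximate eigenvalue on both sides. -/

/-- `a ^ (n + 1) * y = a ^ n` for some `n` and some `y` commuting with `a`; equivalently, `a` has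
a Drazin inverse. -/
def IsStronglyPiRegular {R : Type*} [Monoid R] (a : R) : Prop :=
  ∃ (n : ℕ) (y : R), Commute a y ∧ a ^ (n + 1) * y = a ^ n

section Monoid

variable {R : Type*} [Monoid R] {a y : R} {n : ℕ}

theorem pow_add_mul_pow_eq (h : a ^ (n + 1) * y = a ^ n) (k : ℕ) :
    a ^ (n + k) * y ^ k = a ^ n := by
  induction k with
  | zero => simp
  | succ k ih =>
    calc a ^ (n + (k + 1)) * y ^ (k + 1) = a ^ k * (a ^ (n + 1) * y) * y ^ k := by
          rw [pow_succ' y, show n + (k + 1) = k + (n + 1) by ring, pow_add a k]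
          simp only [mul_assoc]
      _ = a ^ n := by rw [h, ← pow_add, add_comm k n, ih]

theorem pow_succ_mul_of_le (h : a ^ (n + 1) * y = a ^ n) {m : ℕ} (hm : n ≤ m) :
    a ^ (m + 1) * y = a ^ m := by
  obtain ⟨k, rfl⟩ := Nat.exists_eq_add_of_le' hm
  rw [add_assoc, pow_add, mul_assoc, h, ← pow_add]

/-- The Drazin inverse. -/
theorem exists_drazin_inverse (hc : Commute a y) (h : a ^ (n + 1) * y = a ^ n) :
    ∃ x, Commute a x ∧ x * a * x = x ∧ a ^ (n + 1) * x = a ^ n := by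
  -- The element `a ^ n * y ^ n` is idempotent; the witness is `y` cut down by it.
  refine ⟨a ^ n * y ^ (n + 1), (Commute.refl a).pow_right n |>.mul_right (hc.pow_right _), ?_, ?_⟩
  · have h1 := (hc.symm.pow_pow (n + 1) (n + 1)).eq
    have h2 : a ^ n * a = a ^ (n + 1) := (pow_succ a n).symm
    calc a ^ n * y ^ (n + 1) * a * (a ^ n * y ^ (n + 1))
        = a ^ n * (y ^ (n + 1) * a ^ (n + 1)) * y ^ (n + 1) := by
          rw [pow_succ' a n]; simp only [mul_assoc]
      _ = (a ^ (n + (n + 1)) * y ^ (n + 1)) * y ^ (n + 1) := by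
          rw [h1, pow_add a n (n + 1)]; simp only [mul_assoc]
      _ = a ^ n * y ^ (n + 1) := by rw [pow_add_mul_pow_eq h]
  · rw [← mul_assoc, ← pow_add, add_comm (n + 1) n, pow_add_mul_pow_eq h]

theorem _root_.IsUnit.isStronglyPiRegular (ha : IsUnit a) : IsStronglyPiRegular a := by
  obtain ⟨u, rfl⟩ := ha
  exact ⟨0, ↑u⁻¹, by simp [Commute, SemiconjBy], by simp⟩

end Monoid

theorem _root_.IsNilpotent.isStronglyPiRegular {R : Type*} [Ring R] {a : R} (ha : IsNilpotent a) :
    IsStronglyPiRegular a := by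
  obtain ⟨n, hn⟩ := ha
  exact ⟨n, 0, Commute.zero_right a, by simp [hn]⟩

theorem commute_ringInverse {R : Type*} [Ring R] {t x : R} (h : Commute t x) :
    Commute t (Ring.inverse x) := by
  by_cases hx : IsUnit x
  · obtain ⟨u, rfl⟩ := hx
    rw [Ring.inverse_unit]
    exact h.units_inv_right
  · rw [Ring.inverse_non_unit _ hx]
    exact Commute.zero_right t

/-! ### Poles at the origin -/

section Pole

variable {A : Type*} [NormedRing A] [NormedAlgebra ℂ A]

theorem commute_algebraMap (z : ℂ) (t : A) : Commute t (algebraMap ℂ A z) :=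
  (Algebra.commutes z t).symm

theorem eventually_nhds_zero_of_nhdsNE {E : Type*} [TopologicalSpace E] [T2Space E] {f g : ℂ → E}
    (hf : ContinuousAt f 0) (hg : ContinuousAt g 0) (h : ∀ᶠ z in 𝓝[≠] (0 : ℂ), f z = g z) :
    ∀ᶠ z in 𝓝 (0 : ℂ), f z = g z :=
  (hf.eventuallyEq_nhds_iff_eventuallyEq_nhdsNE hg).mp h

/-- If a constant `d` is divisible by `z - a` in the germs of analytic functions at `0`, then it is
divisible by every power of `a`. -/
theorem exists_eq_pow_mul_of_analyticAt [CompleteSpace A] (a : A) (k : ℕ) :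
    ∀ (F : ℂ → A) (d : A), AnalyticAt ℂ F 0 →
      (∀ᶠ z in 𝓝 (0 : ℂ), (algebraMap ℂ A z - a) * F z = d) →
      ∃ y, d = a ^ k * y ∧
        ∀ t, Commute t a → (∀ᶠ z in 𝓝 (0 : ℂ), Commute t (F z)) → Commute t y := by
  induction k with
  | zero =>
    intro F d _ h
    refine ⟨d, by simp, fun t hta ht => ?_⟩
    have h0 := h.self_of_nhds
    rw [← h0]
    exact ((commute_algebraMap 0 t).sub_right hta).mul_right ht.self_of_nhds
  | succ k ih =>
    intro F d hF h
    have hd : d = -(a * F 0) := by rw [← h.self_of_nhds]; simp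
    have hF1 : AnalyticAt ℂ (dslope F 0) 0 := by
      obtain ⟨p, hp⟩ := hF
      exact ⟨p.fslope, hp.has_fpower_series_dslope_fslope⟩
    have key : ∀ z : ℂ, F z = F 0 + z • dslope F 0 z := by
      intro z
      have := sub_smul_dslope F 0 z
      rw [sub_zero] at this
      rw [this]; abel
    -- At `z = 0` the relation reads `d = -(a * F 0)`. Subtracting this and dividing by `z` leaves
    -- `(z - a) * dslope F 0 z = -F 0`, so `-F 0` is again a constant divisible by `z - a`.
    obtain ⟨y, hy, hyc⟩ := ih (dslope F 0) (-F 0) hF1 (by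
      refine eventually_nhds_zero_of_nhdsNE ?_ continuousAt_const ?_
      · exact (((algebraMapCLM ℂ A).continuous.continuousAt).sub continuousAt_const).mul
          hF1.continuousAt
      · filter_upwards [h.filter_mono nhdsWithin_le_nhds, self_mem_nhdsWithin] with z hz hz0
        rw [hd, key z, mul_add, sub_mul, Algebra.algebraMap_eq_smul_one, smul_mul_assoc, one_mul,
          mul_smul_comm] at hz
        have h2 : z • ((algebraMap ℂ A z - a) * dslope F 0 z) = z • (-F 0) := by
          rw [smul_neg, Algebra.algebraMap_eq_smul_one]
          have := congrArg (fun w => w - z • F 0 + a * F 0) hz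
          rw [show -(z • F 0) = -(a * F 0) - z • F 0 + a * F 0 by abel, ← this]
          abel
        exact smul_right_injective A hz0 h2)
    refine ⟨y, ?_, fun t hta ht => hyc t hta ?_⟩
    · rw [hd, pow_succ', mul_assoc, ← hy, mul_neg]
    · refine eventually_nhds_zero_of_nhdsNE (f := fun z => t * dslope F 0 z)
        (g := fun z => dslope F 0 z * t) (continuousAt_const.mul hF1.continuousAt)
        (hF1.continuousAt.mul continuousAt_const) ?_
      filter_upwards [ht.filter_mono nhdsWithin_le_nhds, self_mem_nhdsWithin] with z hz hz0
      have h0 := ht.self_of_nhds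
      have h3 : dslope F 0 z = z⁻¹ • (F z - F 0) := by
        rw [key z, add_sub_cancel_left, smul_smul, inv_mul_cancel₀ hz0, one_smul]
      rw [h3]
      exact ((hz.sub_right h0).smul_right _).eq

theorem resolvent_mul_self {a : A} {z : ℂ} (hz : z ∉ spectrum ℂ a) :
    (algebraMap ℂ A z - a) * resolvent a z = 1 :=
  Ring.mul_inverse_cancel _ (spectrum.notMem_iff.mp hz)

theorem commute_resolvent {a t : A} (h : Commute t a) (z : ℂ) : Commute t (resolvent a z) :=
  commute_ringInverse ((commute_algebraMap z t).sub_right h)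

theorem eventually_notMem_of_not_accPt {K : Set ℂ} {z : ℂ} (h : ¬ AccPt z (𝓟 K)) :
    ∀ᶠ w in 𝓝[≠] z, w ∉ K := by
  rw [accPt_iff_frequently_nhdsNE] at h
  simpa [Filter.not_frequently] using h

/-- If `0` is a pole of the resolvent of `a`, then `a` is strongly π-regular, with an element `y`
in the double commutant of `a`. -/
theorem exists_pow_succ_mul_eq_of_mem_poles [CompleteSpace A] {a : A} (h : 0 ∈ poles a) :
    ∃ (n : ℕ) (y : A), (∀ t, Commute t a → Commute t y) ∧ a ^ (n + 1) * y = a ^ n := by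
  obtain ⟨p, hiso, hp, hord⟩ := h
  have hmer : MeromorphicAt (resolvent a : ℂ → A) 0 :=
    meromorphicAt_of_meromorphicOrderAt_ne_zero (by rw [hord]; norm_cast; omega)
  obtain ⟨G, hG, -, hGe⟩ := (meromorphicOrderAt_eq_int_iff hmer).mp hord
  have hns := eventually_notMem_of_not_accPt hiso.2
  -- `(z - a) * Q z = z ^ p - a ^ p`, while `(z - a) * G z = z ^ p` off the spectrum for `z ≠ 0`
  -- near `0`; the difference is the constant `a ^ p`.
  let Q : ℂ → A := fun z => ∑ i ∈ Finset.range p, (algebraMap ℂ A z) ^ i * a ^ (p - 1 - i)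
  have halg : AnalyticAt ℂ (fun z => algebraMap ℂ A z) 0 := (algebraMapCLM ℂ A).analyticAt 0
  have hQ : AnalyticAt ℂ Q 0 :=
    Finset.analyticAt_fun_sum _ fun i _ => (halg.pow i).mul analyticAt_const
  have hF : AnalyticAt ℂ (fun z => G z - Q z) 0 := hG.sub hQ
  have hGr : ∀ᶠ z in 𝓝[≠] (0 : ℂ), G z = z ^ p • resolvent a z := by
    filter_upwards [hGe, self_mem_nhdsWithin] with z hz hz0
    rw [hz, sub_zero, smul_smul, zpow_neg, zpow_natCast, mul_inv_cancel₀ (pow_ne_zero _ hz0),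
      one_smul]
  have hdiv : ∀ᶠ z in 𝓝 (0 : ℂ), (algebraMap ℂ A z - a) * (G z - Q z) = a ^ p := by
    refine eventually_nhds_zero_of_nhdsNE
      ((halg.continuousAt.sub continuousAt_const).mul hF.continuousAt) continuousAt_const ?_
    filter_upwards [hGr, hns] with z hz hzs
    have hc : Commute (algebraMap ℂ A z) a := Algebra.commutes z a
    rw [mul_sub, hz, mul_smul_comm, resolvent_mul_self hzs, hc.mul_geom_sum₂, ← map_pow,
      Algebra.algebraMap_eq_smul_one]
    abel
  obtain ⟨y, hy, hyc⟩ := exists_eq_pow_mul_of_analyticAt a (p + 1) _ _ hF hdiv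
  refine ⟨p, y, fun t ht => hyc t ht ?_, hy.symm⟩
  refine eventually_nhds_zero_of_nhdsNE (f := fun z => t * (G z - Q z))
    (g := fun z => (G z - Q z) * t) (continuousAt_const.mul hF.continuousAt)
    (hF.continuousAt.mul continuousAt_const) ?_
  filter_upwards [hGr] with z hz
  have hc : Commute t (algebraMap ℂ A z) := commute_algebraMap z t
  refine Commute.sub_right (a := t) ?_ (Commute.sum_right _ _ _ fun i _ =>
    (hc.pow_right _).mul_right (ht.pow_right _))
  rw [hz]
  exact (commute_resolvent ht z).smul_right _

theorem isStronglyPiRegular_of_mem_poles [CompleteSpace A] {a : A} (h : 0 ∈ poles a) :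
    IsStronglyPiRegular a := by
  obtain ⟨n, y, hc, hy⟩ := exists_pow_succ_mul_eq_of_mem_poles h
  exact ⟨n, y, hc a (Commute.refl a), hy⟩

theorem not_isUnit_of_mem_iso {a : A} (h : 0 ∈ iso (spectrum ℂ a)) : ¬ IsUnit a :=
  (spectrum.zero_mem_iff ℂ).mp h.1

/-- The resolvent of an element with Drazin inverse `x`, away from the origin. -/
theorem sub_mul_laurent {a x : A} {n : ℕ} (hc : Commute a x) (hx : x * a * x = x)
    (h : a ^ (n + 1) * x = a ^ n) {z : ℂ} (hz : z ≠ 0) {v : A} (hv : (1 - z • x) * v = 1) :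
    (algebraMap ℂ A z - a) * ((z ^ n)⁻¹ •
      ((∑ i ∈ Finset.range n, (algebraMap ℂ A z) ^ i * a ^ (n - 1 - i)) * (1 - a * x) -
        z ^ n • (x * v))) = 1 := by
  have hcz : Commute (algebraMap ℂ A z) a := Algebra.commutes z a
  -- The idempotent `1 - a * x` cuts out the nilpotent part of `a`, where the geometric sum inverts
  -- `z - a` up to `z ^ n`. On the part `a * x` the inverse is `-(x * v)`.
  have h1 : a ^ n * (1 - a * x) = 0 := by rw [mul_sub, mul_one, ← mul_assoc, ← pow_succ, h, sub_self]
  have h2 : (algebraMap ℂ A z - a) * x = -(a * x * (1 - z • x)) := by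
    have : a * x * x = x := by rw [hc.eq, hx]
    rw [mul_sub, mul_smul_comm, this, sub_mul, Algebra.algebraMap_eq_smul_one, smul_mul_assoc,
      one_mul, mul_one]
    abel
  rw [mul_smul_comm, mul_sub, ← mul_assoc, hcz.mul_geom_sum₂, sub_mul, h1, sub_zero,
    mul_smul_comm, ← mul_assoc, h2, neg_mul, mul_assoc (a * x), hv, mul_one, ← map_pow,
    Algebra.algebraMap_eq_smul_one, smul_mul_assoc, one_mul, ← smul_sub, smul_smul,
    inv_mul_cancel₀ (pow_ne_zero _ hz), one_smul]
  abel

/-- A strongly π-regular element that is not invertible has a pole at the origin. -/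
theorem mem_poles_of_isStronglyPiRegular [CompleteSpace A] {a : A} (hu : ¬ IsUnit a)
    (h : IsStronglyPiRegular a) : 0 ∈ poles a := by
  obtain ⟨n, y, hcy, hy⟩ := h
  obtain ⟨x, hc, hx, h⟩ := exists_drazin_inverse hcy hy
  let L : ℂ → A := fun z =>
    (∑ i ∈ Finset.range n, (algebraMap ℂ A z) ^ i * a ^ (n - 1 - i)) * (1 - a * x) -
      z ^ n • (x * Ring.inverse (1 - z • x))
  have halg : AnalyticAt ℂ (fun z => algebraMap ℂ A z) 0 := (algebraMapCLM ℂ A).analyticAt 0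
  have hlin : AnalyticAt ℂ (fun z : ℂ => 1 - z • x) 0 :=
    analyticAt_const.sub (analyticAt_id.smul analyticAt_const)
  have hinv : AnalyticAt ℂ (fun z : ℂ => Ring.inverse (1 - z • x)) 0 := by
    have h0 : AnalyticAt ℂ (Ring.inverse : A → A) ((fun z : ℂ => 1 - z • x) 0) := by
      simpa using analyticAt_inverse (𝕜 := ℂ) (1 : Aˣ)
    exact AnalyticAt.comp (g := Ring.inverse) (f := fun z : ℂ => 1 - z • x) h0 hlin
  have hL : AnalyticAt ℂ L 0 :=
    ((Finset.analyticAt_fun_sum _ fun i _ => (halg.pow i).mul analyticAt_const).mul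
      analyticAt_const).sub ((analyticAt_id.pow n).smul (analyticAt_const.mul hinv))
  have hunit : ∀ᶠ z in 𝓝 (0 : ℂ), IsUnit (1 - z • x) := by
    refine hlin.continuousAt.eventually (Units.isOpen.mem_nhds ?_)
    simp
  have hright : ∀ᶠ z in 𝓝[≠] (0 : ℂ), (algebraMap ℂ A z - a) * ((z ^ n)⁻¹ • L z) = 1 := by
    filter_upwards [hunit.filter_mono nhdsWithin_le_nhds, self_mem_nhdsWithin] with z hz hz0
    exact sub_mul_laurent hc hx h hz0 (Ring.mul_inverse_cancel _ hz)
  have hcomm : ∀ z, Commute a (L z) := fun z => by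
    have hcz : Commute a (algebraMap ℂ A z) := commute_algebraMap z a
    refine Commute.sub_right ?_ ?_
    · refine (Commute.sum_right _ _ _ fun i _ => ?_).mul_right ?_
      · exact (hcz.pow_right _).mul_right ((Commute.refl a).pow_right _)
      · exact (Commute.one_right a).sub_right ((Commute.refl a).mul_right hc)
    · refine (hc.mul_right ?_).smul_right _
      exact commute_ringInverse ((Commute.one_right a).sub_right (hc.smul_right z))
  have hns : ∀ᶠ z in 𝓝[≠] (0 : ℂ), z ∉ spectrum ℂ a := by
    filter_upwards [hright] with z hz
    rw [spectrum.notMem_iff]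
    refine ⟨⟨_, _, hz, ?_⟩, rfl⟩
    rw [← hz]
    exact ((((commute_algebraMap z (L z)).symm.sub_left (hcomm z)).smul_right _).eq).symm
  have hres : ∀ᶠ z in 𝓝[≠] (0 : ℂ), resolvent a z = (z ^ n)⁻¹ • L z := by
    filter_upwards [hright, hns] with z hz hzs
    exact (spectrum.notMem_iff.mp hzs).mul_left_cancel ((resolvent_mul_self hzs).trans hz.symm)
  have hmer : MeromorphicAt (resolvent a : ℂ → A) 0 := by
    refine MeromorphicAt.congr (f := fun z => (z ^ n)⁻¹ • L z) ?_ (hres.mono fun z hz => hz.symm)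
    exact ((MeromorphicAt.id 0).pow n).inv.smul hL.meromorphicAt
  -- The exponent `n` need not be the order of the pole; only negativity of the order is needed.
  -- Otherwise the resolvent would have a limit at `0`, and this limit would invert `-a`.
  have hneg : meromorphicOrderAt (resolvent a : ℂ → A) 0 < 0 := by
    by_contra hcon
    obtain ⟨c, hlim⟩ := tendsto_nhds_of_meromorphicOrderAt_nonneg hmer (not_lt.mp hcon)
    have hl : Tendsto (fun z => algebraMap ℂ A z - a) (𝓝[≠] (0 : ℂ)) (𝓝 (-a)) := by
      have := halg.continuousAt.tendsto.sub (tendsto_const_nhds (x := a))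
      rw [map_zero, zero_sub] at this
      exact this.mono_left nhdsWithin_le_nhds
    have e1 : -a * c = 1 := tendsto_nhds_unique (hl.mul hlim)
      (tendsto_const_nhds.congr' (hns.mono fun z hz => (resolvent_mul_self hz).symm))
    have e2 : c * -a = 1 := tendsto_nhds_unique (hlim.mul hl)
      (tendsto_const_nhds.congr' (hns.mono fun z hz =>
        (Ring.inverse_mul_cancel _ (spectrum.notMem_iff.mp hz)).symm))
    exact hu (IsUnit.neg_iff a |>.mp ⟨⟨-a, c, e1, e2⟩, rfl⟩)
  have htop : meromorphicOrderAt (resolvent a : ℂ → A) 0 ≠ ⊤ := hneg.ne_top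
  obtain ⟨m, hm⟩ := WithTop.ne_top_iff_exists.mp htop
  have hm0 : m < 0 := by rw [← hm] at hneg; exact_mod_cast hneg
  refine ⟨m.natAbs, ⟨(spectrum.zero_mem_iff ℂ).mpr hu, ?_⟩, by omega, ?_⟩
  · rw [accPt_iff_frequently_nhdsNE, Filter.not_frequently]
    exact hns
  · rw [← hm]; congr 1; omega

theorem zero_mem_poles_iff [CompleteSpace A] {a : A} :
    0 ∈ poles a ↔ ¬ IsUnit a ∧ IsStronglyPiRegular a :=
  ⟨fun h => ⟨not_isUnit_of_mem_iso (let ⟨_, hp⟩ := h; hp.1), isStronglyPiRegular_of_mem_poles h⟩,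
    fun h => mem_poles_of_isStronglyPiRegular h.1 h.2⟩

end Pole

/-! ### Spectra of products and of nilpotent elements -/

section Spectrum

variable {A : Type*} [NormedRing A] [NormedAlgebra ℂ A]

/-- The bicommutant of `{a, b}` is a commutative Banach algebra, so spectral values there are values
of characters, which are multiplicative. It contains the inverse of each of its elements that is
invertible in `A`, so character values also lie in the spectrum taken in `A`. -/
theorem spectrum_mul_subset [CompleteSpace A] {a b : A} (hab : Commute a b) {z : ℂ}
    (hz : z ∈ spectrum ℂ (a * b)) :
    ∃ l ∈ spectrum ℂ a, ∃ m ∈ spectrum ℂ b, l * m = z := by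
  let T : Set A := {a, b}
  let S : Subalgebra ℂ A := Subalgebra.centralizer ℂ T.centralizer
  have hT : T ⊆ S := Set.subset_centralizer_centralizer
  have hTT : ∀ x ∈ T, ∀ y ∈ T, x * y = y * x := by
    rintro x (rfl | rfl) y (rfl | rfl)
    exacts [rfl, hab.eq, hab.eq.symm, rfl]
  have hS : IsClosed (S : Set A) := Set.isClosed_centralizer _
  let _ : NormedCommRing S :=
    { (inferInstance : NormedRing S) with
      mul_comm := fun x y => Subtype.ext
        (Set.centralizer_centralizer_comm_of_comm hTT _ x.2 _ y.2) }
  let _ : NormedAlgebra ℂ S := Subalgebra.toNormedAlgebra S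
  have : CompleteSpace S := hS.completeSpace_coe
  let a' : S := ⟨a, hT (by simp [T])⟩
  let b' : S := ⟨b, hT (by simp [T])⟩
  have hz' : z ∈ spectrum ℂ (a' * b') := spectrum.subset_subalgebra (a' * b') hz
  obtain ⟨f, hf⟩ := WeakDual.CharacterSpace.mem_spectrum_iff_exists.mp hz'
  have key : ∀ x : S, f x ∈ spectrum ℂ (x : A) := by
    intro x hx
    obtain ⟨u, hu⟩ : IsUnit (algebraMap ℂ A (f x) - (x : A)) := hx
    have hmem : ((u⁻¹ : Aˣ) : A) ∈ S := by
      have hux : (u : A) ∈ S := by rw [hu]; exact (algebraMap ℂ S (f x) - x).2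
      intro t ht
      exact ((show Commute t (u : A) from hux t ht).units_inv_right).eq
    have h1 : (algebraMap ℂ S (f x) - x) * ⟨_, hmem⟩ = 1 := by
      apply Subtype.ext
      change (algebraMap ℂ A (f x) - (x : A)) * ((u⁻¹ : Aˣ) : A) = 1
      rw [← hu, Units.mul_inv]
    have h2 := congrArg f h1
    rw [map_mul, map_sub, AlgHomClass.commutes, map_one] at h2
    simp at h2
  exact ⟨f a', key a', f b', key b', by rw [← map_mul, hf]⟩

theorem iso_singleton (z : ℂ) : iso {z} = {z} := by
  refine Set.Subset.antisymm (fun _ h => h.1) ?_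
  rintro w (rfl : w = z)
  refine ⟨rfl, ?_⟩
  rw [accPt_iff_frequently_nhdsNE, Filter.not_frequently]
  exact self_mem_nhdsWithin

theorem poles_subset_spectrum (a : A) : poles a ⊆ spectrum ℂ a := fun _ ⟨_, h⟩ => h.1.1

/-- For the converse, a pole at `0` gives `a ^ n * (1 - a * y) = 0`. As `y` commutes with the
quasinilpotent `a`, `1 - a * y` is a unit. -/
theorem isNilpotent_iff [CompleteSpace A] [Nontrivial A] {a : A} :
    IsNilpotent a ↔ spectrum ℂ a = {0} ∧ poles a = {0} := by
  constructor
  · intro h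
    have hsub : spectrum ℂ a ⊆ {0} := by
      intro z hz
      obtain ⟨n, hn⟩ := h
      have := spectrum.pow_mem_pow (𝕜 := ℂ) a n hz
      rw [hn, spectrum.zero_eq] at this
      exact eq_zero_of_pow_eq_zero this
    have h0 : 0 ∈ poles a :=
      mem_poles_of_isStronglyPiRegular h.not_isUnit h.isStronglyPiRegular
    exact ⟨hsub.antisymm (Set.singleton_subset_iff.mpr (poles_subset_spectrum a h0)),
      ((poles_subset_spectrum a).trans hsub).antisymm (Set.singleton_subset_iff.mpr h0)⟩
  · rintro ⟨h1, h2⟩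
    obtain ⟨n, y, hy, h⟩ := isStronglyPiRegular_of_mem_poles
      (show (0 : ℂ) ∈ poles a by rw [h2]; rfl)
    have hu : IsUnit (1 - a * y) := by
      have : (1 : ℂ) ∉ spectrum ℂ (a * y) := by
        intro hz
        obtain ⟨l, hl, m, -, hlm⟩ := spectrum_mul_subset hy hz
        rw [h1] at hl
        rw [Set.mem_singleton_iff.mp hl, zero_mul] at hlm
        exact zero_ne_one hlm
      simpa using spectrum.notMem_iff.mp this
    refine ⟨n, hu.mul_left_eq_zero.mp ?_⟩
    rw [mul_sub, mul_one, ← mul_assoc, ← pow_succ, h, sub_self]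

/-- If `0` is no accumulation point of the spectra of two commuting elements, then it is none of
the spectrum of their product. -/
theorem not_accPt_spectrum_mul [CompleteSpace A] {a b : A} (hab : Commute a b)
    (ha : ¬ AccPt 0 (𝓟 (spectrum ℂ a))) (hb : ¬ AccPt 0 (𝓟 (spectrum ℂ b))) :
    ¬ AccPt 0 (𝓟 (spectrum ℂ (a * b))) := by
  have key : ∀ K : Set ℂ, ¬ AccPt 0 (𝓟 K) ↔ ∃ ε > 0, ∀ z ∈ K, z ≠ 0 → ε ≤ ‖z‖ := by
    intro K
    rw [accPt_iff_frequently_nhdsNE, Filter.not_frequently, eventually_nhdsWithin_iff,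
      Metric.eventually_nhds_iff]
    refine exists_congr fun ε => and_congr_right fun _ => ?_
    simp only [dist_zero_right]
    exact forall_congr' fun z => ⟨fun h hz h0 => not_lt.mp fun hlt => h hlt h0 hz,
      fun h hlt h0 hz => not_le.mpr hlt (h hz h0)⟩
  rw [key] at *
  obtain ⟨ε, hε, h1⟩ := ha
  obtain ⟨δ, hδ, h2⟩ := hb
  refine ⟨ε * δ, mul_pos hε hδ, fun z hz h0 => ?_⟩
  obtain ⟨l, hl, m, hm, rfl⟩ := spectrum_mul_subset hab hz
  rw [norm_mul]
  exact mul_le_mul (h1 l hl (left_ne_zero_of_mul h0)) (h2 m hm (right_ne_zero_of_mul h0)) hδ.le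
    (norm_nonneg _)

/-- A spectral value of maximal modulus is a two-sided approximate eigenvalue. -/
theorem exists_approximate_eigenvector [CompleteSpace A] {b : A} {m : ℂ}
    (hm : m ∈ spectrum ℂ b) (hmax : ∀ z ∈ spectrum ℂ b, ‖z‖ ≤ ‖m‖) (hm0 : m ≠ 0) {ε : ℝ}
    (hε : 0 < ε) :
    ∃ y : A, ‖y‖ = 1 ∧ ‖(b - algebraMap ℂ A m) * y‖ ≤ ε ∧ ‖y * (b - algebraMap ℂ A m)‖ ≤ ε := by
  -- Chosen so that `δ + δ * ‖1‖ = ε`; the norm of `1` may exceed `1`.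
  set δ : ℝ := ε / (‖(1 : A)‖ + 1) with hδ
  have hone : 0 < ‖(1 : A)‖ + 1 := by positivity
  have hδ0 : 0 < δ := by positivity
  have hmn : 0 < ‖m‖ := norm_pos_iff.mpr hm0
  -- Moving `m` radially outwards by `δ` leaves the spectrum, by maximality of `‖m‖`.
  let z : ℂ := m + (δ / ‖m‖ : ℝ) • m
  have hzm : ‖z - m‖ = δ := by
    simp only [z, add_sub_cancel_left, norm_smul, Real.norm_eq_abs]
    rw [abs_of_pos (by positivity), div_mul_cancel₀ _ hmn.ne']
  have hz : z ∉ spectrum ℂ b := by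
    intro hz
    have h1 : ‖z‖ = (1 + δ / ‖m‖) * ‖m‖ := by
      have : z = (1 + δ / ‖m‖ : ℝ) • m := by rw [add_smul, one_smul]
      rw [this, norm_smul, Real.norm_eq_abs, abs_of_pos (by positivity)]
    have h2 := hmax z hz
    rw [h1, add_mul, one_mul, div_mul_cancel₀ _ hmn.ne'] at h2
    linarith
  set R := resolvent b z with hR
  have hunit := spectrum.notMem_iff.mp hz
  have hR1 : (algebraMap ℂ A z - b) * R = 1 := Ring.mul_inverse_cancel _ hunit
  have hR2 : R * (algebraMap ℂ A z - b) = 1 := Ring.inverse_mul_cancel _ hunit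
  -- The resolvent is large near a spectral value, so `R / ‖R‖` is the approximate eigenvector; it
  -- commutes with `b`, hence serves on both sides.
  have hnorm : 1 ≤ δ * ‖R‖ := by
    by_contra! hlt
    have hlt' : ‖(z - m) • R‖ < 1 := by rwa [norm_smul, hzm]
    have h1 : algebraMap ℂ A m - b = (algebraMap ℂ A z - b) * (1 - (z - m) • R) := by
      rw [mul_sub, mul_one, mul_smul_comm, hR1, sub_smul, Algebra.algebraMap_eq_smul_one,
        Algebra.algebraMap_eq_smul_one]
      abel
    refine hm (?_ : IsUnit (algebraMap ℂ A m - b))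
    rw [h1]
    exact hunit.mul (Units.oneSub _ hlt').isUnit
  have hRpos : 0 < ‖R‖ := by
    by_contra! hle
    nlinarith
  have hinv : ‖R‖⁻¹ ≤ δ := by
    rw [inv_le_iff_one_le_mul₀ hRpos]; exact hnorm
  have e0 : b - algebraMap ℂ A m = (z - m) • (1 : A) - (algebraMap ℂ A z - b) := by
    rw [sub_smul, Algebra.algebraMap_eq_smul_one, Algebra.algebraMap_eq_smul_one]
    abel
  have e1 : (b - algebraMap ℂ A m) * R = (z - m) • R - 1 := by
    rw [e0, sub_mul, hR1, smul_mul_assoc, one_mul]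
  have e2 : R * (b - algebraMap ℂ A m) = (z - m) • R - 1 := by
    rw [e0, mul_sub, hR2, mul_smul_comm, mul_one]
  have hn : ‖(‖R‖⁻¹ : ℝ)‖ = ‖R‖⁻¹ := by rw [Real.norm_eq_abs, abs_of_pos (by positivity)]
  have hle : ‖((‖R‖⁻¹ : ℝ) : ℂ) • ((z - m) • R - 1)‖ ≤ ε := by
    rw [norm_smul, Complex.norm_real, hn]
    calc ‖R‖⁻¹ * ‖(z - m) • R - 1‖ ≤ ‖R‖⁻¹ * (δ * ‖R‖ + ‖(1 : A)‖) := by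
          gcongr
          exact (norm_sub_le _ _).trans_eq (by rw [norm_smul, hzm])
      _ = δ + ‖R‖⁻¹ * ‖(1 : A)‖ := by field_simp
      _ ≤ δ + δ * ‖(1 : A)‖ := by gcongr
      _ = ε := by rw [hδ]; field_simp; ring
  refine ⟨((‖R‖⁻¹ : ℝ) : ℂ) • R, ?_, ?_, ?_⟩
  · rw [norm_smul, Complex.norm_real, hn, inv_mul_cancel₀ hRpos.ne']
  · rwa [mul_smul_comm, e1]
  · rwa [smul_mul_assoc, e2]

theorem exists_spectrum_max_ne_zero [CompleteSpace A] [Nontrivial A] {b : A}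
    (hb : spectrum ℂ b ≠ {0}) :
    ∃ m ∈ spectrum ℂ b, (∀ z ∈ spectrum ℂ b, ‖z‖ ≤ ‖m‖) ∧ m ≠ 0 := by
  have hne := spectrum.nonempty b
  obtain ⟨m, hm, hmax⟩ := (spectrum.isCompact (𝕜 := ℂ) b).exists_isMaxOn hne
    continuous_norm.continuousOn
  refine ⟨m, hm, hmax, ?_⟩
  rintro rfl
  refine hb (hne.subset_singleton_iff.mp fun z hz => ?_)
  simpa using hmax hz

end Spectrum

/-! ### Commuting copies of two Banach algebras with slice maps -/

section Pair

variable {A B C : Type*} [NormedRing A] [NormedAlgebra ℂ A] [NormedRing B] [NormedAlgebra ℂ B]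
  [NormedRing C] [NormedAlgebra ℂ C]

/-- Every functional `g` on `B` gives a slice map `C → A`, which is a map of `A`-bimodules. -/
def HasSlices (i : A →ₐ[ℂ] C) (j : B →ₐ[ℂ] C) : Prop :=
  ∀ g : B →L[ℂ] ℂ, ∃ φ : C →L[ℂ] A, ‖φ‖ ≤ ‖g‖ ∧ (∀ y, φ (j y) = algebraMap ℂ A (g y)) ∧
    (∀ x w, φ (i x * w) = x * φ w) ∧ ∀ x w, φ (w * i x) = φ w * x

/-- Commuting homomorphisms `i`, `j` into `C` such that `(x, y) ↦ i x * j y` is a crossnormed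
bilinear map with slice maps on both sides. -/
structure IsCrossPair (i : A →ₐ[ℂ] C) (j : B →ₐ[ℂ] C) : Prop where
  commute : ∀ x y, Commute (i x) (j y)
  norm_mul : ∀ x y, ‖i x * j y‖ = ‖x‖ * ‖y‖
  slice_left : HasSlices i j
  slice_right : HasSlices j i

namespace IsCrossPair

variable {i : A →ₐ[ℂ] C} {j : B →ₐ[ℂ] C}

theorem symm (h : IsCrossPair i j) : IsCrossPair j i where
  commute x y := (h.commute y x).symm
  norm_mul x y := by rw [← (h.commute y x).eq, h.norm_mul, mul_comm]
  slice_left := h.slice_right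
  slice_right := h.slice_left

theorem mul_eq_zero (h : IsCrossPair i j) {x : A} {y : B} (hxy : i x * j y = 0) :
    x = 0 ∨ y = 0 := by
  have := h.norm_mul x y
  rw [hxy, norm_zero, eq_comm, _root_.mul_eq_zero] at this
  simpa using this

theorem nontrivial (h : IsCrossPair i j) [Nontrivial A] [Nontrivial B] : Nontrivial C := by
  refine ⟨⟨i 1 * j 1, 0, fun h0 => ?_⟩⟩
  rcases h.mul_eq_zero h0 with h1 | h1 <;> exact one_ne_zero h1

theorem mul_pow (h : IsCrossPair i j) (a : A) (b : B) (n : ℕ) :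
    (i a * j b) ^ n = i (a ^ n) * j (b ^ n) := by
  rw [(h.commute a b).mul_pow, map_pow, map_pow]

theorem isNilpotent_iff (h : IsCrossPair i j) {a : A} {b : B} :
    IsNilpotent (i a * j b) ↔ IsNilpotent a ∨ IsNilpotent b := by
  constructor
  · rintro ⟨n, hn⟩
    rw [h.mul_pow] at hn
    exact (h.mul_eq_zero hn).imp (fun h => ⟨n, h⟩) fun h => ⟨n, h⟩
  · rintro (⟨n, hn⟩ | ⟨n, hn⟩) <;> exact ⟨n, by rw [h.mul_pow, hn]; simp⟩

theorem isStronglyPiRegular (h : IsCrossPair i j) {a : A} {b : B} (ha : IsStronglyPiRegular a)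
    (hb : IsStronglyPiRegular b) : IsStronglyPiRegular (i a * j b) := by
  obtain ⟨n, x, hax, hx⟩ := ha
  obtain ⟨k, y, hby, hy⟩ := hb
  refine ⟨max n k, i x * j y, ?_, ?_⟩
  · exact Commute.mul_left ((hax.map i).mul_right (h.commute a y))
      (((h.commute x b).symm).mul_right (hby.map j))
  · rw [h.mul_pow, h.mul_pow, mul_assoc, ← mul_assoc (j _) (i x), ← (h.commute x _).eq, mul_assoc,
      ← mul_assoc, ← map_mul, ← map_mul, pow_succ_mul_of_le hx (le_max_left _ _),
      pow_succ_mul_of_le hy (le_max_right _ _)]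

/-- The first factor of a unit is a unit. -/
theorem isUnit_left (h : IsCrossPair i j) [Nontrivial B] {a : A} {b : B}
    (hu : IsUnit (i a * j b)) : IsUnit a := by
  have hia : IsUnit (i a) := ((h.commute a b).isUnit_mul_iff.mp hu).1
  obtain ⟨u, hu⟩ := hia
  -- Slicing with a functional equal to `1` at `1` sends the inverse of `i a` to an inverse of `a`.
  obtain ⟨g, -, hg⟩ := exists_dual_vector ℂ (1 : B) (by simp)
  obtain ⟨φ, -, hφ, hl, hr⟩ := h.slice_left (((‖(1 : B)‖ : ℂ)⁻¹) • g)
  have h1 : φ 1 = 1 := by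
    have := hφ 1
    rw [map_one] at this
    rw [this]
    simp [hg]
  refine ⟨⟨a, φ ((u⁻¹ : Cˣ) : C), ?_, ?_⟩, rfl⟩
  · rw [← hl, ← hu, Units.mul_inv, h1]
  · rw [← hr, ← hu, Units.inv_mul, h1]

/-- If `i a * j b` is strongly π-regular through `d` in its double commutant and `a` is not
nilpotent, then `b` is
strongly π-regular. -/
theorem isStronglyPiRegular_right (h : IsCrossPair i j) {a : A} {b : B} (ha : ¬ IsNilpotent a)
    {n : ℕ} {d : C} (hd : ∀ t, Commute t (i a * j b) → Commute t d)
    (hn : (i a * j b) ^ (n + 1) * d = (i a * j b) ^ n) : IsStronglyPiRegular b := by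
  have han : a ^ n ≠ 0 := fun h0 => ha ⟨n, h0⟩
  have hnorm : ‖a ^ n‖ ≠ 0 := norm_ne_zero_iff.mpr han
  obtain ⟨f, -, hf⟩ := exists_dual_vector ℂ (a ^ n) hnorm
  obtain ⟨φ, -, hφ, hl, hr⟩ := h.slice_right (((‖a ^ n‖ : ℂ)⁻¹) • f)
  have h1 : φ (i (a ^ n)) = 1 := by rw [hφ]; simp [hf, hnorm]
  -- Here the double commutant matters: commuting with `i a * j b` alone would not make `d` commute
  -- with `j b`.
  have hjd : Commute (j b) d :=
    hd _ (((h.commute a b).symm).mul_right (Commute.refl _))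
  refine ⟨n, φ (i (a ^ (n + 1)) * d), ?_, ?_⟩
  · show b * _ = _ * b
    rw [← hl, ← hr, ← mul_assoc, ← (h.commute _ b).eq, mul_assoc, hjd.eq, mul_assoc]
  · rw [← hl, ← mul_assoc, ← (h.commute _ _).eq, ← h.mul_pow, hn, h.mul_pow, (h.commute _ _).eq,
      hl, h1, mul_one]

/-- Let `W` invert `l * m - i a * j b`, which equals `m • i (l - a) - i a * j (b - m)`. On an
approximate eigenvector `j y` the second term is negligible, so slicing `W * j y` and `j y * W` with
`g y = 1` gives one-sided inverses of `l - a` up to an error of norm below `1`. -/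
theorem mem_spectrum (h : IsCrossPair i j) [CompleteSpace A] [CompleteSpace B] {a : A} {b : B}
    {l m : ℂ} (hl : l ∈ spectrum ℂ a) (hm : m ∈ spectrum ℂ b)
    (hmax : ∀ z ∈ spectrum ℂ b, ‖z‖ ≤ ‖m‖) (hm0 : m ≠ 0) :
    l * m ∈ spectrum ℂ (i a * j b) := by
  intro hu
  obtain ⟨u, hu⟩ : IsUnit (algebraMap ℂ C (l * m) - i a * j b) := hu
  set W : C := ((u⁻¹ : Cˣ) : C) with hW
  set α : A := algebraMap ℂ A l - a with hα
  have hsplit : (u : C) = m • i α - i a * j (b - algebraMap ℂ B m) := by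
    rw [hu, hα, map_sub, map_sub, AlgHomClass.commutes, AlgHomClass.commutes, mul_sub, map_mul,
      Algebra.algebraMap_eq_smul_one, Algebra.algebraMap_eq_smul_one, smul_sub, smul_mul_assoc,
      one_mul, mul_smul_comm, mul_one, smul_comm m l]
    abel
  -- Keeps the error bound `‖W‖ * ‖a‖ * ε` below `1`; the `+ 1` covers `a = 0`.
  set ε : ℝ := (2 * (‖W‖ * ‖a‖ + 1))⁻¹ with hε
  have hε0 : 0 < ε := by positivity
  have hbound : ‖W‖ * ‖a‖ * ε < 1 := by
    rw [hε, ← div_eq_mul_inv, div_lt_one (by positivity)]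
    nlinarith [norm_nonneg W, norm_nonneg a, mul_nonneg (norm_nonneg W) (norm_nonneg a)]
  obtain ⟨y, hy, hy1, hy2⟩ := exists_approximate_eigenvector hm hmax hm0 hε0
  obtain ⟨g, hg, hgy⟩ := exists_dual_vector ℂ y (by rw [hy]; exact one_ne_zero)
  obtain ⟨φ, hφn, hφ, hφl, hφr⟩ := h.slice_left g
  rw [hg] at hφn
  have hφy : φ (j y) = 1 := by rw [hφ, hgy, hy]; simp
  have herr1 : ‖φ (W * (i a * j ((b - algebraMap ℂ B m) * y)))‖ < 1 := by
    calc _ ≤ 1 * ‖W * (i a * j ((b - algebraMap ℂ B m) * y))‖ := φ.le_of_opNorm_le hφn _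
      _ ≤ ‖W‖ * (‖a‖ * ε) := by
          rw [one_mul]
          refine (norm_mul_le _ _).trans ?_
          rw [h.norm_mul]
          gcongr
      _ < 1 := by rwa [← mul_assoc]
  have herr2 : ‖φ ((i a * j (y * (b - algebraMap ℂ B m))) * W)‖ < 1 := by
    calc _ ≤ 1 * ‖(i a * j (y * (b - algebraMap ℂ B m))) * W‖ := φ.le_of_opNorm_le hφn _
      _ ≤ (‖a‖ * ε) * ‖W‖ := by
          rw [one_mul]
          refine (norm_mul_le _ _).trans ?_
          rw [h.norm_mul]
          gcongr
      _ < 1 := by rwa [mul_comm, ← mul_assoc]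
  have hleft : (m • φ (W * j y)) * α = 1 - -φ (W * (i a * j ((b - algebraMap ℂ B m) * y))) := by
    have e : j y = W * (u : C) * j y := by rw [hW, Units.inv_mul, one_mul]
    have e2 : W * (u : C) * j y = m • (W * j y * i α) -
        W * (i a * j ((b - algebraMap ℂ B m) * y)) := by
      rw [hsplit, mul_sub, sub_mul, mul_smul_comm, smul_mul_assoc, mul_assoc W (i α),
        (h.commute α y).eq, map_mul]
      simp only [mul_assoc]
    have e3 := congrArg φ (e.trans e2)
    rw [hφy, map_sub, map_smul, hφr] at e3
    rw [smul_mul_assoc, sub_neg_eq_add, e3, sub_add_cancel]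
  have hright : α * (m • φ (j y * W)) = 1 - -φ ((i a * j (y * (b - algebraMap ℂ B m))) * W) := by
    have e : j y = j y * ((u : C) * W) := by rw [hW, Units.mul_inv, mul_one]
    have e2 : j y * ((u : C) * W) = m • (i α * (j y * W)) -
        (i a * j (y * (b - algebraMap ℂ B m))) * W := by
      rw [hsplit, sub_mul, mul_sub, smul_mul_assoc, mul_smul_comm, ← mul_assoc (j y) (i α),
        ← (h.commute α y).eq, mul_assoc (i a), ← mul_assoc (j y) (i a), ← (h.commute a y).eq,
        map_mul]
      simp only [mul_assoc]
    have e3 := congrArg φ (e.trans e2)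
    rw [hφy, map_sub, map_smul, hφl] at e3
    rw [mul_smul_comm, sub_neg_eq_add, e3, sub_add_cancel]
  have hul : IsUnit ((m • φ (W * j y)) * α) := by
    rw [hleft]; exact (Units.oneSub _ (by rwa [norm_neg])).isUnit
  have hur : IsUnit (α * (m • φ (j y * W))) := by
    rw [hright]; exact (Units.oneSub _ (by rwa [norm_neg])).isUnit
  obtain ⟨p, hp⟩ := hul.exists_left_inv
  obtain ⟨q, hq⟩ := hur.exists_right_inv
  rw [← mul_assoc] at hp
  rw [mul_assoc] at hq
  refine hl ⟨⟨α, _, hq, ?_⟩, rfl⟩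
  rwa [← left_inv_eq_right_inv hp hq]

theorem spectrum_eq_zero_iff (h : IsCrossPair i j) [CompleteSpace A] [CompleteSpace B]
    [CompleteSpace C] [Nontrivial A] [Nontrivial B] {a : A} {b : B} :
    spectrum ℂ (i a * j b) = {0} ↔ spectrum ℂ a = {0} ∨ spectrum ℂ b = {0} := by
  have := h.nontrivial
  constructor
  · intro hc
    by_contra! hcon
    obtain ⟨l, hl, -, hl0⟩ := exists_spectrum_max_ne_zero hcon.1
    obtain ⟨m, hm, hmax, hm0⟩ := exists_spectrum_max_ne_zero hcon.2
    have := h.mem_spectrum hl hm hmax hm0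
    rw [hc] at this
    exact mul_ne_zero hl0 hm0 this
  · intro hab
    refine (spectrum.nonempty _).subset_singleton_iff.mp fun z hz => ?_
    obtain ⟨l, hl, m, hm, rfl⟩ := spectrum_mul_subset (h.commute a b) hz
    have hl' := AlgHom.spectrum_apply_subset i a hl
    have hm' := AlgHom.spectrum_apply_subset j b hm
    rcases hab with h0 | h0
    · rw [h0] at hl'
      rw [Set.mem_singleton_iff.mp hl', zero_mul]; rfl
    · rw [h0] at hm'
      rw [Set.mem_singleton_iff.mp hm', mul_zero]; rfl

/-- Multiplication by a fixed nonzero `m ∈ σ(b)` of maximal modulus carries points of `σ(a)` tending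
to `0` to such points of the spectrum of the tensor. -/
theorem zero_mem_acc (h : IsCrossPair i j) [CompleteSpace A] [CompleteSpace B] [Nontrivial B]
    {a : A} {b : B} (hb : spectrum ℂ b ≠ {0}) (ha : 0 ∈ acc (spectrum ℂ a)) :
    0 ∈ acc (spectrum ℂ (i a * j b)) := by
  obtain ⟨m, hm, hmax, hm0⟩ := exists_spectrum_max_ne_zero hb
  have hacc : AccPt 0 (𝓟 (spectrum ℂ a)) := by
    by_contra hn
    exact ha.2 ⟨ha.1, hn⟩
  have h0 : (0 : ℂ) ∈ spectrum ℂ (i a * j b) := by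
    simpa using h.mem_spectrum ha.1 hm hmax hm0
  refine ⟨h0, fun hiso => hiso.2 ?_⟩
  rw [accPt_iff_frequently_nhdsNE] at hacc ⊢
  have ht : Tendsto (fun z : ℂ => z * m) (𝓝[≠] 0) (𝓝[≠] 0) := by
    refine tendsto_nhdsWithin_iff.mpr ⟨?_, ?_⟩
    · have : Tendsto (fun z : ℂ => z * m) (𝓝 0) (𝓝 (0 * m)) :=
        (continuous_id.mul continuous_const).tendsto 0
      rw [zero_mul] at this
      exact this.mono_left nhdsWithin_le_nhds
    · filter_upwards [self_mem_nhdsWithin] with z hz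
      exact mul_ne_zero hz hm0
  exact ht.frequently (hacc.mono fun z hz => h.mem_spectrum hz hm hmax hm0)

theorem not_accPt (h : IsCrossPair i j) [CompleteSpace C] {a : A} {b : B}
    (ha : ¬ AccPt 0 (𝓟 (spectrum ℂ a))) (hb : ¬ AccPt 0 (𝓟 (spectrum ℂ b))) :
    ¬ AccPt 0 (𝓟 (spectrum ℂ (i a * j b))) :=
  not_accPt_spectrum_mul (h.commute a b)
    (fun hc => ha (hc.mono (principal_mono.mpr (AlgHom.spectrum_apply_subset i a))))
    (fun hc => hb (hc.mono (principal_mono.mpr (AlgHom.spectrum_apply_subset j b))))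

/-- If `a` is not nilpotent and `0` is an isolated point of `σ(b)` that is not a pole, then `0` is
such a point of the spectrum of the tensor, provided that `0` is no accumulation point of `σ(a)`. -/
theorem zero_mem_nonpoles (h : IsCrossPair i j) [CompleteSpace B] [CompleteSpace C] [Nontrivial A]
    {a : A} {b : B} (ha : ¬ IsNilpotent a) (hacc : ¬ AccPt 0 (𝓟 (spectrum ℂ a)))
    (hb : 0 ∈ nonpoles b) : 0 ∈ nonpoles (i a * j b) := by
  have hbu : ¬ IsUnit b := not_isUnit_of_mem_iso hb.1
  have hu : ¬ IsUnit (i a * j b) := fun hu => hbu (h.symm.isUnit_left ((h.commute a b).eq ▸ hu))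
  refine ⟨⟨(spectrum.zero_mem_iff ℂ).mpr hu, h.not_accPt hacc hb.1.2⟩, fun hp => hb.2 ?_⟩
  obtain ⟨n, d, hd, hn⟩ := exists_pow_succ_mul_eq_of_mem_poles hp
  -- A pole of the tensor would slice down to a pole of `b`.
  exact mem_poles_of_isStronglyPiRegular hbu (h.isStronglyPiRegular_right ha hd hn)

end IsCrossPair

end Pair

theorem not_accPt_of_isUnit {A : Type*} [NormedRing A] [NormedAlgebra ℂ A] [CompleteSpace A] {a : A}
    (ha : IsUnit a) : ¬ AccPt 0 (𝓟 (spectrum ℂ a)) := by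
  rw [accPt_iff_frequently_nhdsNE, Filter.not_frequently]
  refine (IsOpen.mem_nhds (spectrum.isClosed a).isOpen_compl ?_ : _ ∈ 𝓝 (0 : ℂ)) |>
    mem_nhdsWithin_of_mem_nhds
  exact (spectrum.zero_notMem_iff ℂ).mpr ha

/-! ### The completed tensor product -/

section CompletedTensorProduct

variable {A B : Type*} [NormedRing A] [NormedAlgebra ℂ A] [NormedRing B] [NormedAlgebra ℂ B]

/-- The embedding of `A ⊗ B` into its completion. -/
noncomputable def ofTensor (α : AlgebraNorm ℂ (A ⊗[ℂ] B)) : (A ⊗[ℂ] B) →ₐ[ℂ] CompletedTensor α where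
  toRingHom := UniformSpace.Completion.coeRingHom.comp
    (NormedTensor.of α : (A ⊗[ℂ] B) →+* NormedTensor α)
  commutes' _ := rfl

theorem ofTensor_apply (α : AlgebraNorm ℂ (A ⊗[ℂ] B)) (w : A ⊗[ℂ] B) :
    ofTensor α w = (NormedTensor.of α w : CompletedTensor α) := rfl

theorem norm_ofTensor (α : AlgebraNorm ℂ (A ⊗[ℂ] B)) (w : A ⊗[ℂ] B) : ‖ofTensor α w‖ = α w := by
  rw [ofTensor_apply, UniformSpace.Completion.norm_coe, NormedTensor.norm_of]

theorem denseRange_ofTensor (α : AlgebraNorm ℂ (A ⊗[ℂ] B)) : DenseRange (ofTensor α) :=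
  UniformSpace.Completion.denseRange_coe.comp (NormedTensor.of α).surjective.denseRange
    (UniformSpace.Completion.continuous_coe _)

/-- A bounded bimodule map on `A ⊗ B` extends to the completion. -/
theorem exists_extension {D : Type*} [NormedRing D] [NormedAlgebra ℂ D] [CompleteSpace D]
    (α : AlgebraNorm ℂ (A ⊗[ℂ] B)) (k : D →ₐ[ℂ] A ⊗[ℂ] B) (φ : A ⊗[ℂ] B →ₗ[ℂ] D) {M : ℝ}
    (hM : 0 ≤ M) (hφ : ∀ w, ‖φ w‖ ≤ M * α w) (hl : ∀ x w, φ (k x * w) = x * φ w)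
    (hr : ∀ x w, φ (w * k x) = φ w * x) :
    ∃ ψ : CompletedTensor α →L[ℂ] D, ‖ψ‖ ≤ M ∧ (∀ w, ψ (ofTensor α w) = φ w) ∧
      (∀ x w, ψ (ofTensor α (k x) * w) = x * ψ w) ∧
      ∀ x w, ψ (w * ofTensor α (k x)) = ψ w * x := by
  let e : A ⊗[ℂ] B →ₗ[ℂ] CompletedTensor α := (ofTensor α).toLinearMap
  have he : DenseRange e := denseRange_ofTensor α
  have hb : ∀ w, ‖φ w‖ ≤ M * ‖e w‖ := fun w => by
    rw [show ‖e w‖ = α w from norm_ofTensor α w]; exact hφ w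
  have hψ : ∀ w, φ.extendOfNorm e (ofTensor α w) = φ w :=
    fun w => LinearMap.extendOfNorm_eq he ⟨M, hb⟩ w
  refine ⟨φ.extendOfNorm e, ContinuousLinearMap.opNorm_le_bound _ hM fun w =>
    LinearMap.norm_extendOfNorm_apply_le he _ hb w, hψ, fun x w => ?_, fun x w => ?_⟩
  · refine (denseRange_ofTensor α).induction_on w (isClosed_eq (by fun_prop) (by fun_prop)) ?_
    intro w
    rw [← map_mul, hψ, hψ, hl]
  · refine (denseRange_ofTensor α).induction_on w (isClosed_eq (by fun_prop) (by fun_prop)) ?_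
    intro w
    rw [← map_mul, hψ, hψ, hr]

variable {α : AlgebraNorm ℂ (A ⊗[ℂ] B)}

/-- The slice map is `id ⊗ g`. Uniformity speaks only of operators on `A` and `B`, so `g` is
replaced by the rank-one operator `y ↦ g y • 1`; the crossnorm property then lets the factor `‖1‖`
cancel. -/
theorem hasSlices_left [CompleteSpace A] [Nontrivial B] (hα : IsUniformCrossnorm α) :
    HasSlices ((ofTensor α).comp Algebra.TensorProduct.includeLeft)
      ((ofTensor α).comp (Algebra.TensorProduct.includeRight : B →ₐ[ℂ] A ⊗[ℂ] B)) := by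
  intro g
  let φ : A ⊗[ℂ] B →ₗ[ℂ] A :=
    (TensorProduct.rid ℂ A).toLinearMap ∘ₗ TensorProduct.map LinearMap.id (g : B →ₗ[ℂ] ℂ)
  have hφt : ∀ x y, φ (x ⊗ₜ y) = g y • x := fun x y => by simp [φ]
  have hφ : ∀ w, ‖φ w‖ ≤ ‖g‖ * α w := by
    intro w
    have h1 : φ w ⊗ₜ[ℂ] (1 : B) = TensorProduct.map ((ContinuousLinearMap.id ℂ A : A →L[ℂ] A) :
        A →ₗ[ℂ] A) ((g.smulRight (1 : B) : B →L[ℂ] B) : B →ₗ[ℂ] B) w := by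
      induction w with
      | zero => simp
      | tmul x y => rw [hφt]; simp [TensorProduct.smul_tmul]
      | add u v hu hv => rw [map_add, TensorProduct.add_tmul, hu, hv, map_add]
    have h2 := hα.uniform (ContinuousLinearMap.id ℂ A) (g.smulRight (1 : B)) w
    rw [← h1, hα.cross, ContinuousLinearMap.norm_smulRight_apply] at h2
    have hone : 0 < ‖(1 : B)‖ := norm_pos_iff.mpr one_ne_zero
    have h3 : ‖ContinuousLinearMap.id ℂ A‖ * (‖g‖ * ‖(1 : B)‖) * α w ≤
        1 * (‖g‖ * ‖(1 : B)‖) * α w := by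
      gcongr
      exact ContinuousLinearMap.norm_id_le
    refine le_of_mul_le_mul_right ((h2.trans h3).trans_eq ?_) hone
    ring
  obtain ⟨ψ, hψ, he, hl, hr⟩ := exists_extension α Algebra.TensorProduct.includeLeft φ
    (norm_nonneg g) hφ
    (fun x w => by
      induction w with
      | zero => simp
      | tmul u v => simp [hφt]
      | add u v hu hv => rw [mul_add, map_add, hu, hv, map_add, mul_add])
    (fun x w => by
      induction w with
      | zero => simp
      | tmul u v => simp [hφt]
      | add u v hu hv => rw [add_mul, map_add, hu, hv, map_add, add_mul])
  refine ⟨ψ, hψ, fun y => ?_, hl, hr⟩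
  rw [AlgHom.comp_apply, he, Algebra.TensorProduct.includeRight_apply, hφt,
    Algebra.algebraMap_eq_smul_one]

theorem hasSlices_right [CompleteSpace B] [Nontrivial A] (hα : IsUniformCrossnorm α) :
    HasSlices ((ofTensor α).comp (Algebra.TensorProduct.includeRight : B →ₐ[ℂ] A ⊗[ℂ] B))
      ((ofTensor α).comp Algebra.TensorProduct.includeLeft) := by
  intro g
  let φ : A ⊗[ℂ] B →ₗ[ℂ] B :=
    (TensorProduct.lid ℂ B).toLinearMap ∘ₗ TensorProduct.map (g : A →ₗ[ℂ] ℂ) LinearMap.id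
  have hφt : ∀ x y, φ (x ⊗ₜ y) = g x • y := fun x y => by simp [φ]
  have hφ : ∀ w, ‖φ w‖ ≤ ‖g‖ * α w := by
    intro w
    have h1 : (1 : A) ⊗ₜ[ℂ] φ w = TensorProduct.map ((g.smulRight (1 : A) : A →L[ℂ] A) :
        A →ₗ[ℂ] A) ((ContinuousLinearMap.id ℂ B : B →L[ℂ] B) : B →ₗ[ℂ] B) w := by
      induction w with
      | zero => simp
      | tmul x y => rw [hφt]; simp [TensorProduct.smul_tmul]
      | add u v hu hv => rw [map_add, TensorProduct.tmul_add, hu, hv, map_add]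
    have h2 := hα.uniform (g.smulRight (1 : A)) (ContinuousLinearMap.id ℂ B) w
    rw [← h1, hα.cross, ContinuousLinearMap.norm_smulRight_apply] at h2
    have hone : 0 < ‖(1 : A)‖ := norm_pos_iff.mpr one_ne_zero
    have h3 : ‖g‖ * ‖(1 : A)‖ * ‖ContinuousLinearMap.id ℂ B‖ * α w ≤
        ‖g‖ * ‖(1 : A)‖ * 1 * α w := by
      gcongr
      exact ContinuousLinearMap.norm_id_le
    refine le_of_mul_le_mul_left ((h2.trans h3).trans_eq ?_) hone
    ring
  obtain ⟨ψ, hψ, he, hl, hr⟩ := exists_extension α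
    (Algebra.TensorProduct.includeRight : B →ₐ[ℂ] A ⊗[ℂ] B) φ (norm_nonneg g) hφ
    (fun x w => by
      induction w with
      | zero => simp
      | tmul u v => simp [hφt]
      | add u v hu hv => rw [mul_add, map_add, hu, hv, map_add, mul_add])
    (fun x w => by
      induction w with
      | zero => simp
      | tmul u v => simp [hφt]
      | add u v hu hv => rw [add_mul, map_add, hu, hv, map_add, add_mul])
  refine ⟨ψ, hψ, fun y => ?_, hl, hr⟩
  rw [AlgHom.comp_apply, he, Algebra.TensorProduct.includeLeft_apply, hφt,
    Algebra.algebraMap_eq_smul_one]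

theorem IsUniformCrossnorm.isCrossPair [CompleteSpace A] [CompleteSpace B] [Nontrivial A]
    [Nontrivial B] (hα : IsUniformCrossnorm α) :
    IsCrossPair ((ofTensor α).comp Algebra.TensorProduct.includeLeft)
      ((ofTensor α).comp (Algebra.TensorProduct.includeRight : B →ₐ[ℂ] A ⊗[ℂ] B)) where
  commute x y := by
    refine Commute.map (?_ : Commute (x ⊗ₜ[ℂ] (1 : B)) ((1 : A) ⊗ₜ[ℂ] y)) (ofTensor α)
    simp [Commute, SemiconjBy]
  norm_mul x y := by
    rw [AlgHom.comp_apply, AlgHom.comp_apply, ← map_mul, norm_ofTensor]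
    simp [hα.cross]
  slice_left := hasSlices_left hα
  slice_right := hasSlices_right hα

theorem tmul_eq (a : A) (b : B) :
    tmul α a b = (ofTensor α).comp Algebra.TensorProduct.includeLeft a *
      (ofTensor α).comp (Algebra.TensorProduct.includeRight : B →ₐ[ℂ] A ⊗[ℂ] B) b := by
  rw [AlgHom.comp_apply, AlgHom.comp_apply, ← map_mul]
  simp [tmul, ofTensor_apply]

end CompletedTensorProduct

theorem not_isNilpotent_of_mem_nonpoles {A : Type*} [NormedRing A] [NormedAlgebra ℂ A]
    [CompleteSpace A] {a : A} (h : 0 ∈ nonpoles a) : ¬ IsNilpotent a := fun hn =>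
  h.2 (mem_poles_of_isStronglyPiRegular (not_isUnit_of_mem_iso h.1) hn.isStronglyPiRegular)

/-- For an element that is not nilpotent, `σ(a) = I(a) = {0}` just means that `a` is
quasinilpotent. -/
theorem spectrum_eq_zero_and_nonpoles_iff {A : Type*} [NormedRing A] [NormedAlgebra ℂ A]
    [CompleteSpace A] [Nontrivial A] {a : A} (hn : ¬ IsNilpotent a) :
    spectrum ℂ a = {0} ∧ nonpoles a = {0} ↔ spectrum ℂ a = {0} := by
  refine ⟨fun h => h.1, fun h => ⟨h, ?_⟩⟩
  have hp : 0 ∉ poles a := fun h0 => hn <| isNilpotent_iff.mpr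
    ⟨h, (h ▸ poles_subset_spectrum a).antisymm (Set.singleton_subset_iff.mpr h0)⟩
  rw [nonpoles, h, iso_singleton]
  refine Set.Subset.antisymm (fun _ hz => hz.1) ?_
  rintro _ rfl
  exact ⟨rfl, hp⟩

namespace IsCrossPair

variable {A B C : Type*} [NormedRing A] [NormedAlgebra ℂ A] [NormedRing B] [NormedAlgebra ℂ B]
  [NormedRing C] [NormedAlgebra ℂ C] [CompleteSpace A] [CompleteSpace C]
  [Nontrivial B] {i : A →ₐ[ℂ] C} {j : B →ₐ[ℂ] C}

/-- The hypothesis on `b` covers both an invertible `b` and one with a pole at `0`. -/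
theorem zero_mem_poles (h : IsCrossPair i j) {a : A} {b : B} (ha : 0 ∈ poles a)
    (hb : IsStronglyPiRegular b) : 0 ∈ poles (i a * j b) := by
  rw [zero_mem_poles_iff] at ha ⊢
  exact ⟨fun hu => ha.1 (h.isUnit_left hu), h.isStronglyPiRegular ha.2 hb⟩

end IsCrossPair

end TensorSpectrum

theorem theorem3p2 {A : Type*} {B : Type*}
    [NormedRing A] [NormedAlgebra ℂ A] [CompleteSpace A] [Nontrivial A]
    [NormedRing B] [NormedAlgebra ℂ B] [CompleteSpace B] [Nontrivial B]
    (α : AlgebraNorm ℂ (A ⊗[ℂ] B)) (hα : TensorSpectrum.IsUniformCrossnorm α) (a : A) (b : B) :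
    -- (i)
    (((spectrum ℂ a = {0} ∧ TensorSpectrum.poles a = {0}) ∨
        (spectrum ℂ b = {0} ∧ TensorSpectrum.poles b = {0})) ↔
      (spectrum ℂ (TensorSpectrum.tmul α a b) = {0} ∧
        TensorSpectrum.poles (TensorSpectrum.tmul α a b) = {0})) ∧
    -- (ii)
    (¬ IsNilpotent a → ¬ IsNilpotent b →
      (((spectrum ℂ a = {0} ∧ TensorSpectrum.nonpoles a = {0}) ∨
          (spectrum ℂ b = {0} ∧ TensorSpectrum.nonpoles b = {0})) ↔
        (spectrum ℂ (TensorSpectrum.tmul α a b) = {0} ∧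
          TensorSpectrum.nonpoles (TensorSpectrum.tmul α a b) = {0}))) ∧
    -- (iii)
    ((0 ∈ TensorSpectrum.poles a ∧ IsUnit b) ∨ (0 ∈ TensorSpectrum.poles b ∧ IsUnit a) ∨
        (0 ∈ TensorSpectrum.poles a ∩ TensorSpectrum.poles b) →
      0 ∈ TensorSpectrum.poles (TensorSpectrum.tmul α a b)) ∧
    -- (iv)
    ((¬ IsNilpotent a → 0 ∈ TensorSpectrum.poles a → 0 ∈ TensorSpectrum.nonpoles b →
        0 ∈ TensorSpectrum.nonpoles (TensorSpectrum.tmul α a b)) ∧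
      (¬ IsNilpotent b → 0 ∈ TensorSpectrum.poles b → 0 ∈ TensorSpectrum.nonpoles a →
        0 ∈ TensorSpectrum.nonpoles (TensorSpectrum.tmul α a b))) ∧
    -- (v)
    ((IsUnit b → 0 ∈ TensorSpectrum.nonpoles a →
        0 ∈ TensorSpectrum.nonpoles (TensorSpectrum.tmul α a b)) ∧
      (IsUnit a → 0 ∈ TensorSpectrum.nonpoles b →
        0 ∈ TensorSpectrum.nonpoles (TensorSpectrum.tmul α a b))) ∧
    -- (vi)
    (0 ∈ TensorSpectrum.nonpoles a ∩ TensorSpectrum.nonpoles b →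
      0 ∈ TensorSpectrum.nonpoles (TensorSpectrum.tmul α a b)) ∧
    -- (vii)
    ((spectrum ℂ b ≠ {0} → 0 ∈ TensorSpectrum.acc (spectrum ℂ a) →
        0 ∈ TensorSpectrum.acc (spectrum ℂ (TensorSpectrum.tmul α a b))) ∧
      (spectrum ℂ a ≠ {0} → 0 ∈ TensorSpectrum.acc (spectrum ℂ b) →
        0 ∈ TensorSpectrum.acc (spectrum ℂ (TensorSpectrum.tmul α a b)))) := by
  have h := hα.isCrossPair
  have hnt := h.nontrivial
  -- Swapping the factors reduces each mirrored half to `h.symm`.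
  have hc := (h.commute a b).eq
  rw [TensorSpectrum.tmul_eq]
  refine ⟨?_, fun ha hb => ?_, ?_, ⟨fun ha hpa hb => ?_, fun hb hpb ha => ?_⟩,
    ⟨fun hb ha => ?_, fun ha hb => ?_⟩, fun hab => ?_, fun hb ha => h.zero_mem_acc hb ha,
    fun ha hb => ?_⟩
  · rw [← TensorSpectrum.isNilpotent_iff, ← TensorSpectrum.isNilpotent_iff,
      ← TensorSpectrum.isNilpotent_iff, h.isNilpotent_iff]
  · rw [TensorSpectrum.spectrum_eq_zero_and_nonpoles_iff ha,
      TensorSpectrum.spectrum_eq_zero_and_nonpoles_iff hb,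
      TensorSpectrum.spectrum_eq_zero_and_nonpoles_iff
        fun hn => (h.isNilpotent_iff.mp hn).elim ha hb,
      h.spectrum_eq_zero_iff]
  · rintro (⟨ha, hb⟩ | ⟨hb, ha⟩ | ⟨ha, hb⟩)
    · exact h.zero_mem_poles ha hb.isStronglyPiRegular
    · rw [hc]
      exact h.symm.zero_mem_poles hb ha.isStronglyPiRegular
    · exact h.zero_mem_poles ha (TensorSpectrum.isStronglyPiRegular_of_mem_poles hb)
  -- (iv), (v) and (vi) have one cause: one factor is not nilpotent and its spectrum does not
  -- accumulate at `0`, while `0` is an isolated non-pole of the other.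
  · obtain ⟨_, hpa⟩ := hpa
    exact h.zero_mem_nonpoles ha hpa.1.2 hb
  · obtain ⟨_, hpb⟩ := hpb
    rw [hc]
    exact h.symm.zero_mem_nonpoles hb hpb.1.2 ha
  · rw [hc]
    exact h.symm.zero_mem_nonpoles (fun hn => hn.not_isUnit hb)
      (TensorSpectrum.not_accPt_of_isUnit hb) ha
  · exact h.zero_mem_nonpoles (fun hn => hn.not_isUnit ha)
      (TensorSpectrum.not_accPt_of_isUnit ha) hb
  · exact h.zero_mem_nonpoles (TensorSpectrum.not_isNilpotent_of_mem_nonpoles hab.1)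
      hab.1.1.2 hab.2
  · rw [hc]
    exact h.symm.zero_mem_acc ha hb
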